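/- Let $X$ be a finite or countably infinite set, $Y=\{0,1\}$, and let $C$ be a class of functions $X\to Y$ of finite VC dimension $d$. Let $n\ge 1$. Let $\mathsf{ERM}$ be a deterministic oracle that, given $\mathbf{x}\in X^n$ and $\mathbf{y}\in Y^n$, returns a classifier in $C$ that minimizes over $C$ the number of errors on $(\mathbf{x},\mathbf{y})$. For a distribution $D$ on $X\times Y$, $h:X\to Y$ and $S\subseteq X$, put $\mathrm{err}_D(h|_S)=\Pr_{(x,y)\sim D}[h(x)\ne y\wedge x\in S]$, $\mathrm{err}_D(h)=\mathrm{err}_D(h|_X)$ and $\mathrm{rej}_D(S)=\Pr_{(x,y)\sim D}[x\notin S]$. For $\mathbf{x}\in X^n$ and $c:X\to Y$, put $\mathrm{err}_{\mathbf{x}}(h|_S,c)=\frac1n|\{i: c(x_i)\neq h(x_i)\wedge x_i\in S\}|$ and $\mathrm{err}_{\mathbf{x}}(h,c)=\mathrm{err}_{\mathbf{x}}(h|_X,c)$. The algorithm $\mathsf{Rejectron}(\mathbf{x},\mathbf{y},\tilde{\mathbf{x}},\varepsilon,\Lambda)$, on training examples $\mathbf{x}\in X^n$ with labels $\mathbf{y}\in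 Y^n$ and unlabeled test examples $\tilde{\mathbf{x}}\in X^n$, computes $h=\mathsf{ERM}(\mathbf{x},\mathbf{y})$ and then, for $t=1,2,\dots$, sets $S_t=\{x\in X: h(x)=c_1(x)=\dots=c_{t-1}(x)\}$ (so $S_1=X$), chooses $c_t\in C$ maximizing $s_t(c)=\mathrm{err}_{\tilde{\mathbf{x}}}(h|_{S_t},c)-\Lambda\,\mathrm{err}_{\mathbf{x}}(h,c)$ over $c\in C$ (ties may be broken in any way), and, if $s_t(c_t)\le\varepsilon$, stops and returns $h|_S$ with $S=S_t$. The following holds. 1. (Well-definedness.) For all $\varepsilon>0$, $\Lambda\ge 0$ and all inputs $\mathbf{x},\mathbf{y},\tilde{\mathbf{x}}$, maximizers exist in every round, and the algorithm halts whatever maximizers it chooses. 2. (Trade-off.) Let $\mu,\tilde\mu$ be distributions on $X\times Y$, let $\delta\in(0,1)$ and $\varepsilon\ge 4\sqrt{\frac{d\ln (2n)+\ln(24/\delta)}{n}}$. For every $f\in C$ and $\Lambda\ge 0$, with probability at least $1-\delta$ over $(\mathbf{x},\mathbf{y})\sim\mu^n$ and, independently, $(\tilde{\mathbf{x}},\tilde{\mathbf{y}})\sim\tilde\mu^n$,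 every output $h|_S$ of $\mathsf{Rejectron}(\mathbf{x},\mathbf{y},\tilde{\mathbf{x}},\varepsilon,\Lambda)$ satisfies $$\mathrm{err}_{\tilde\mu}(h|_S)\le 8\Lambda\,\mathrm{err}_\mu(f)+2\,\mathrm{err}_{\tilde\mu}(f)+\Lambda\varepsilon^2+3\varepsilon .$$ For every $\Lambda>0$, with probability at least $1-\delta$ over $(\mathbf{x},\mathbf{y})\sim\mu^n$, for all $\tilde{\mathbf{x}}\in X^n$ every output $h|_S$ of $\mathsf{Rejectron}(\mathbf{x},\mathbf{y},\tilde{\mathbf{x}},\varepsilon,\Lambda)$ satisfies $\mathrm{rej}_\mu(S)\le \frac{2}{\Lambda}+2\varepsilon$. 3. (Agnostic generalization.) Let $\delta\in(0,1)$, $\eta,\tilde\eta\in[0,1)$, and let $\mu,\tilde\mu$ be distributions on $X\times Y$ such that some $f\in C$ satisfies both $\mathrm{err}_\mu(f)\le\eta$ and $\mathrm{err}_{\tilde\mu}(f)\le\tilde\eta$. Put $\varepsilon^*=4\sqrt{\frac{d\ln (2n)+\ln(48/\delta)}{n}}$ and $\Lambda^*=\sqrt{\frac{1}{8\eta+(\varepsilon^*)^2}}$.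 With probability at least $1-\delta$ over $(\mathbf{x},\mathbf{y})\sim\mu^n$ and, independently, $(\tilde{\mathbf{x}},\tilde{\mathbf{y}})\sim\tilde\mu^n$, every output $h|_S$ of $\mathsf{Rejectron}(\mathbf{x},\mathbf{y},\tilde{\mathbf{x}},\varepsilon^*,\Lambda^*)$ satisfies $$\mathrm{err}_{\tilde\mu}(h|_S)\le 2\sqrt{2\eta}+2\tilde\eta+4\varepsilon^*\qquad\text{and}\qquad \mathrm{rej}_\mu(S)\le 4\sqrt{2\eta}+4\varepsilon^* .$$ -/

import Mathlib

open MeasureTheory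

/-- The class `C` of binary classifiers shatters the finite set `A`: every labelling of `A`
is realized by a member of `C`. -/
def ShattersSet {X : Type*} (C : Set (X → Bool)) (A : Finset X) : Prop :=
  ∀ g : X → Bool, ∃ c ∈ C, ∀ x ∈ A, c x = g x

/-- The VC dimension of `C`: the supremum of the sizes of the finite sets shattered by `C`. -/
noncomputable def classVCDim {X : Type*} (C : Set (X → Bool)) : ℕ∞ :=
  ⨆ (A : Finset X) (_ : ShattersSet C A), (A.card : ℕ∞)

/-- `err_D(h|_S) = Pr_{(x,y) ∼ D}[h(x) ≠ y ∧ x ∈ S]`, the error of a selective classifier. -/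
noncomputable def selErr {X : Type*} [MeasurableSpace X] (D : Measure (X × Bool))
    (h : X → Bool) (S : Set X) : ℝ :=
  D.real {p | h p.1 ≠ p.2 ∧ p.1 ∈ S}

/-- `err_D(f) = Pr_{(x,y) ∼ D}[f(x) ≠ y]`, the error of a classifier. -/
noncomputable def clfErr {X : Type*} [MeasurableSpace X] (D : Measure (X × Bool))
    (f : X → Bool) : ℝ :=
  D.real {p | f p.1 ≠ p.2}

/-- `rej_D(S) = Pr_{(x,y) ∼ D}[x ∉ S]`, the rejection rate. -/
noncomputable def rejRate {X : Type*} [MeasurableSpace X] (D : Measure (X × Bool))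
    (S : Set X) : ℝ :=
  D.real {p | p.1 ∉ S}

/-- `err_x(h|_S, f) = (1/n) |{i : f(x_i) ≠ h(x_i) ∧ x_i ∈ S}|`, the empirical disagreement
of the selective classifier `h|_S` with `f` on the examples `x`. -/
noncomputable def empErr {X : Type*} {n : ℕ} (x : Fin n → X) (h : X → Bool) (S : Set X)
    (f : X → Bool) : ℝ :=
  (Nat.card {i : Fin n // f (x i) ≠ h (x i) ∧ x i ∈ S} : ℝ) / n

/-- The fraction of the labeled examples `(x, y)` that `c` misclassifies. -/
noncomputable def trainErr {X : Type*} {n : ℕ} (x : Fin n → X) (y : Fin n → Bool)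
    (c : X → Bool) : ℝ :=
  (Nat.card {i : Fin n // c (x i) ≠ y i} : ℝ) / n

/-- `erm` is a (deterministic) empirical risk minimization oracle for `C` on samples of
size `n`: it returns a member of `C` of minimal error on the labeled examples. -/
def IsERM {X : Type*} {n : ℕ} (C : Set (X → Bool))
    (erm : (Fin n → X) → (Fin n → Bool) → X → Bool) : Prop :=
  ∀ x y, erm x y ∈ C ∧ ∀ c ∈ C, trainErr x y (erm x y) ≤ trainErr x y c

/-- The selected set after the choices `c 0, …, c (t - 1)`; rounds are counted from `0`, so
that it is the set with which round `t` starts, and `rejectronSet h c 0` is everything. -/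
def rejectronSet {X : Type*} (h : X → Bool) (c : ℕ → X → Bool) (t : ℕ) : Set X :=
  {x | ∀ i < t, h x = c i x}

/-- The score `s(g) = err_x̃(h|_S, g) - Λ · err_x(h, g)` of a candidate `g`, given the current
selected set `S`. -/
noncomputable def rejectronScore {X : Type*} {n : ℕ} (x xt : Fin n → X) (Λ : ℝ)
    (h : X → Bool) (S : Set X) (g : X → Bool) : ℝ :=
  empErr xt h S g - Λ * empErr x h Set.univ g

/-- In round `t` of Rejectron the classifier `c t` is an admissible choice: it belongs to `C`
and maximizes the score of that round over `C`. Ties may be broken in any way. -/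
def IsRejectronChoice {X : Type*} {n : ℕ} (C : Set (X → Bool)) (x xt : Fin n → X) (Λ : ℝ)
    (h : X → Bool) (c : ℕ → X → Bool) (t : ℕ) : Prop :=
  c t ∈ C ∧ ∀ g ∈ C,
    rejectronScore x xt Λ h (rejectronSet h c t) g ≤
      rejectronScore x xt Λ h (rejectronSet h c t) (c t)

/-- The stopping criterion of Rejectron in round `t`. -/
def RejectronStops {X : Type*} {n : ℕ} (x xt : Fin n → X) (ε Λ : ℝ)
    (h : X → Bool) (c : ℕ → X → Bool) (t : ℕ) : Prop :=
  rejectronScore x xt Λ h (rejectronSet h c t) (c t) ≤ ε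

/-- `S` is the selected set of an execution of `Rejectron(x, y, x̃, ε, Λ)` with the oracle
`erm`: with `h = erm x y`, the rounds `0, …, T` make admissible choices, round `T` is the first
that meets the stopping criterion, and `S` is the set with which that round started.
The output of this execution is the selective classifier `h|_S`. -/
def IsRejectronOutput {X : Type*} {n : ℕ} (C : Set (X → Bool))
    (erm : (Fin n → X) → (Fin n → Bool) → X → Bool)
    (x : Fin n → X) (y : Fin n → Bool) (xt : Fin n → X) (ε Λ : ℝ) (S : Set X) : Prop :=
  ∃ (c : ℕ → X → Bool) (T : ℕ),
    (∀ t ≤ T, IsRejectronChoice C x xt Λ (erm x y) c t) ∧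
    (∀ t < T, ¬ RejectronStops x xt ε Λ (erm x y) c t) ∧
    RejectronStops x xt ε Λ (erm x y) c T ∧
    S = rejectronSet (erm x y) c T

/-- The law of `n` independent draws from `D`. -/
noncomputable def iidLaw {Z : Type*} [MeasurableSpace Z] (n : ℕ) (D : Measure Z) :
    Measure (Fin n → Z) :=
  Measure.pi fun _ => D

/-- The unlabeled examples of a labeled sample. -/
def samplePts {X : Type*} {n : ℕ} (w : Fin n → X × Bool) : Fin n → X := fun i => (w i).1

/-- The labels of a labeled sample. -/
def sampleLabels {X : Type*} {n : ℕ} (w : Fin n → X × Bool) : Fin n → Bool := fun i => (w i).2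

/-! The proof has a deterministic part and a uniform deviation bound.

Deterministic part: the regions cut off in successive rounds are disjoint, so their test fractions
add up to at most 1. Each round that does not stop cuts off more than `ε` plus `Λ` times the
training disagreement of its choice. Summing (`rounds_mul_add_le_one`) gives at most `1 / ε` rounds
before stopping and, for `Λ > 0`, total training disagreement at most `1 / Λ`, which bounds the
rejected training fraction. At the stopping round, maximality compares the choice with `f`; since
`h` has no more training errors than `f`, this bounds the test disagreement of `h` and `f` on `S`
(`empErr_output_le`).

Passage to the distributions: `S` depends on the samples, but it is always described by `h` and at
most `⌊1 / ε⌋` members of `C`. By Sauer-Shelah such sets have few traces on `2 * n` points, so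
`vc_relative_deviation` bounds all their probabilities at once by twice the empirical frequency plus
`ε`. Its proof is symmetrization by a ghost sample, random swaps within pairs, and a union bound
over traces. The fixed `f` needs only a Chernoff bound for its training error. As `X` is countable
with measurable singletons, every event is measurable. -/

/-- The number of entries of the sample `w` that lie in `A`. -/
noncomputable def sampleHits {Z : Type*} {n : ℕ} (A : Set Z) (w : Fin n → Z) : ℝ :=
  ∑ i, A.indicator (fun _ => (1 : ℝ)) (w i)

instance {Z : Type*} [MeasurableSpace Z] (n : ℕ) (P : Measure Z) [IsProbabilityMeasure P] :
    IsProbabilityMeasure (iidLaw n P) := by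
  unfold iidLaw; infer_instance

theorem sampleHits_nonneg {Z : Type*} {n : ℕ} (A : Set Z) (w : Fin n → Z) :
    0 ≤ sampleHits A w :=
  Finset.sum_nonneg fun _ _ => Set.indicator_nonneg (fun _ _ => zero_le_one) _

theorem sampleHits_le {Z : Type*} {n : ℕ} (A : Set Z) (w : Fin n → Z) :
    sampleHits A w ≤ n := by
  calc sampleHits A w ≤ ∑ _i : Fin n, (1 : ℝ) :=
        Finset.sum_le_sum fun i _ => Set.indicator_le_self' (fun _ _ => zero_le_one) _
    _ = n := by simp

theorem sampleHits_mono {Z : Type*} {n : ℕ} {A B : Set Z} (h : A ⊆ B) (w : Fin n → Z) :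
    sampleHits A w ≤ sampleHits B w :=
  Finset.sum_le_sum fun _ _ => Set.indicator_le_indicator_of_subset h (fun _ => zero_le_one) _

theorem natCard_eq_sampleHits {Z : Type*} {n : ℕ} (A : Set Z) (w : Fin n → Z) :
    (Nat.card {i : Fin n // w i ∈ A} : ℝ) = sampleHits A w := by
  classical
  rw [Nat.card_eq_fintype_card, Fintype.card_subtype, sampleHits]
  simp [Set.indicator_apply]

/-! ### Chernoff bounds for a single set. -/

section Tails

variable {Z : Type*} [MeasurableSpace Z] [DiscreteMeasurableSpace Z]

theorem integrable_of_bounded_discrete {W : Type*} [MeasurableSpace W] [DiscreteMeasurableSpace W]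
    (Q : Measure W) [IsFiniteMeasure Q] (f : W → ℝ) (b : ℝ) (hb : ∀ w, |f w| ≤ b) :
    Integrable f Q :=
  Integrable.of_bound (Measurable.of_discrete (f := f)).aestronglyMeasurable b
    (Filter.Eventually.of_forall hb)

theorem integrable_exp_sampleHits [Countable Z] (n : ℕ) (P : Measure Z) [IsProbabilityMeasure P]
    (A : Set Z) (l : ℝ) :
    Integrable (fun w : Fin n → Z => Real.exp (l * sampleHits A w)) (iidLaw n P) := by
  refine integrable_of_bounded_discrete _ _ (Real.exp (|l| * n)) fun w => ?_
  rw [abs_of_pos (Real.exp_pos _)]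
  refine Real.exp_le_exp.2 ((mul_le_mul_of_nonneg_right (le_abs_self l)
    (sampleHits_nonneg A w)).trans ?_)
  exact mul_le_mul_of_nonneg_left (sampleHits_le A w) (abs_nonneg l)

theorem mgf_sampleHits_le (n : ℕ) (P : Measure Z) [IsProbabilityMeasure P] (A : Set Z) (l : ℝ) :
    ProbabilityTheory.mgf (sampleHits A) (iidLaw n P) l ≤
      Real.exp (n * P.real A * (Real.exp l - 1)) := by
  have hone : ∫ z, Real.exp (l * A.indicator (fun _ => (1 : ℝ)) z) ∂P =
      1 + P.real A * (Real.exp l - 1) := by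
    have : (fun z => Real.exp (l * A.indicator (fun _ => (1 : ℝ)) z)) =
        fun z => 1 + A.indicator (fun _ => Real.exp l - 1) z := by
      funext z
      by_cases hz : z ∈ A <;> simp [hz]
    rw [this, integral_add (integrable_const _)
      ((integrable_const _).indicator (MeasurableSet.of_discrete)),
      integral_indicator (MeasurableSet.of_discrete)]
    simp
  have hprod : ProbabilityTheory.mgf (sampleHits A) (iidLaw n P) l =
      (1 + P.real A * (Real.exp l - 1)) ^ n := by
    unfold ProbabilityTheory.mgf iidLaw sampleHits
    simp_rw [Finset.mul_sum, Real.exp_sum]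
    rw [integral_fintype_prod_eq_prod (𝕜 := ℝ) (fun _ : Fin n => fun z =>
      Real.exp (l * A.indicator (fun _ => (1 : ℝ)) z))]
    simp [hone]
  have hnn : 0 ≤ 1 + P.real A * (Real.exp l - 1) := by
    rw [← hone]; exact integral_nonneg fun _ => (Real.exp_pos _).le
  rw [hprod]
  calc (1 + P.real A * (Real.exp l - 1)) ^ n
      ≤ (Real.exp (P.real A * (Real.exp l - 1))) ^ n := by
        gcongr; rw [add_comm]; exact Real.add_one_le_exp _
    _ = _ := by rw [← Real.exp_nat_mul, mul_assoc]

/-- Chernoff with exponent parameter 1: the factor 2 absorbs `exp 1 - 1 < 2`, so only the additive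
term `a` remains in the exponent. -/
theorem sampleHits_upper_tail [Countable Z] (n : ℕ) (P : Measure Z) [IsProbabilityMeasure P]
    (A : Set Z) (a : ℝ) :
    (iidLaw n P).real {w | n * (2 * P.real A + a) ≤ sampleHits A w} ≤ Real.exp (-(n * a)) := by
  refine (ProbabilityTheory.measure_ge_le_exp_mul_mgf _ zero_le_one
    (integrable_exp_sampleHits n P A 1)).trans ?_
  refine (mul_le_mul_of_nonneg_left (mgf_sampleHits_le n P A 1) (Real.exp_pos _).le).trans ?_
  rw [← Real.exp_add]
  refine Real.exp_le_exp.2 ?_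
  have h1 := Real.exp_one_lt_d9
  have h2 : 0 ≤ n * P.real A := by positivity
  nlinarith

theorem sampleHits_lower_tail [Countable Z] (n : ℕ) (P : Measure Z) [IsProbabilityMeasure P]
    (A : Set Z) (hA : 96 ≤ n * P.real A) :
    (iidLaw n P).real {w | sampleHits A w ≤ 3 / 4 * (n * P.real A)} ≤ 1 / 2 := by
  refine (ProbabilityTheory.measure_le_le_exp_mul_mgf _ (t := -(1 / 4)) (by norm_num)
    (integrable_exp_sampleHits n P A (-(1 / 4)))).trans ?_
  refine (mul_le_mul_of_nonneg_left (mgf_sampleHits_le n P A _) (Real.exp_pos _).le).trans ?_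
  rw [← Real.exp_add]
  have h1 : Real.exp (-(1 / 4)) ≤ 4 / 5 := by
    rw [Real.exp_neg, inv_le_comm₀ (Real.exp_pos _) (by norm_num)]
    have := Real.add_one_le_exp (1 / 4)
    linarith
  calc _ ≤ Real.exp (-1) := by
        refine Real.exp_le_exp.2 ?_
        -- The exponent is at most `(3 / 16 - 1 / 5) * (n * P.real A)`, that is `-(n * P.real A) /
        -- 80`; this is below `-1` because `96 ≥ 80`.
        nlinarith
    _ ≤ 1 / 2 := by
        rw [Real.exp_neg, inv_le_comm₀ (Real.exp_pos _) (by norm_num)]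
        have := Real.exp_one_gt_d9
        linarith

end Tails

/-! ### Counting traces of a class of finite VC dimension. -/

theorem sum_choose_range_le_two_mul_pow (m d : ℕ) (hm : 2 ≤ m) :
    ∑ k ∈ Finset.range (d + 1), m.choose k ≤ 2 * m ^ d := by
  induction d with
  | zero => simp
  | succ d ih =>
    rw [Finset.sum_range_succ, pow_succ]
    have h1 : m.choose (d + 1) ≤ m ^ d * m := by
      rw [← pow_succ]; exact Nat.choose_le_pow m (d + 1)
    have h2 : m ^ d * 2 ≤ m ^ d * m := Nat.mul_le_mul_left _ hm
    omega

/-- The Sauer-Shelah bound: on at most `m` points the class `C` has at most `2 * m ^ d` traces. -/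
theorem exists_trace_representatives {X : Type*} (C : Set (X → Bool)) (d : ℕ)
    (hd : classVCDim C ≤ d) (W : Finset X) (m : ℕ) (hm : 2 ≤ m) (hW : W.card ≤ m) :
    ∃ R : Finset (X → Bool), ↑R ⊆ C ∧ R.card ≤ 2 * m ^ d ∧
      ∀ c ∈ C, ∃ r ∈ R, ∀ x ∈ W, r x = c x := by
  classical
  let tr : (X → Bool) → Finset W := fun c => Finset.univ.filter fun x => c x = true
  let F : Finset (Finset W) := Finset.univ.filter fun s => ∃ c ∈ C, tr c = s
  have hF : ∀ s : F, ∃ c ∈ C, tr c = s := fun s => (Finset.mem_filter.1 s.2).2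
  choose g hgC hg using hF
  -- One representative in `C` is kept for each trace realized on `W`.
  refine ⟨Finset.univ.image g, ?_, ?_, ?_⟩
  · intro c hc
    obtain ⟨s, _, rfl⟩ := Finset.mem_image.1 (Finset.mem_coe.1 hc)
    exact hgC s
  · have hvc : F.vcDim ≤ d := by
      refine Finset.sup_le fun s hs => ?_
      rw [Finset.mem_shatterer] at hs
      have hsh : ShattersSet C (s.map (Function.Embedding.subtype _)) := by
        intro b
        obtain ⟨u, hu, hsu⟩ := hs (t := s.filter fun x => b x = true) (Finset.filter_subset _ _)
        obtain ⟨c, hc, rfl⟩ := (Finset.mem_filter.1 hu).2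
        refine ⟨c, hc, fun x hx => ?_⟩
        obtain ⟨y, hy, rfl⟩ := Finset.mem_map.1 hx
        have := Finset.ext_iff.1 hsu y
        simp only [tr, Finset.mem_inter, Finset.mem_filter, Finset.mem_univ, true_and, hy] at this
        exact Bool.eq_iff_iff.2 this
      have h1 : ((s.map (Function.Embedding.subtype _)).card : ℕ∞) ≤ classVCDim C :=
        le_iSup₂ (f := fun (A : Finset X) (_ : ShattersSet C A) => (A.card : ℕ∞)) _ hsh
      rw [Finset.card_map] at h1
      exact_mod_cast h1.trans hd
    calc (Finset.univ.image g).card ≤ (Finset.univ : Finset F).card := Finset.card_image_le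
      _ = F.card := by simp
      _ ≤ F.shatterer.card := Finset.card_le_card_shatterer F
      _ ≤ ∑ k ∈ Finset.Iic F.vcDim, (Fintype.card W).choose k :=
          Finset.card_shatterer_le_sum_vcDim
      _ ≤ ∑ k ∈ Finset.Iic F.vcDim, m.choose k :=
          Finset.sum_le_sum fun k _ => Nat.choose_le_choose k (by simpa using hW)
      _ ≤ ∑ k ∈ Finset.range (d + 1), m.choose k :=
          Finset.sum_le_sum_of_subset fun k hk => by
            simp only [Finset.mem_Iic, Finset.mem_range] at hk ⊢; omega
      _ ≤ 2 * m ^ d := sum_choose_range_le_two_mul_pow m d hm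
  · intro c hc
    have hmem : tr c ∈ F := Finset.mem_filter.2 ⟨Finset.mem_univ _, c, hc, rfl⟩
    refine ⟨g ⟨tr c, hmem⟩, Finset.mem_image_of_mem _ (Finset.mem_univ _), fun x hx => ?_⟩
    have := Finset.ext_iff.1 (hg ⟨tr c, hmem⟩) ⟨x, hx⟩
    simp only [tr, Finset.mem_filter, Finset.mem_univ, true_and] at this
    exact Bool.eq_iff_iff.2 this

/-! ### Symmetrization by random swaps. -/

/-- This makes the exponential moment of a randomly swapped pair at most 1. The ratio of the weights
is forced by `9 / 20 = 2 * (3 / 4) * (3 / 10)`: the 2 is the factor of the relative deviation, the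
`3 / 4` comes from the lower tail of the ghost sample. -/
theorem exp_add_exp_neg_le_two : Real.exp (3 / 10) + Real.exp (-(9 / 20)) ≤ 2 := by
  set u := Real.exp (3 / 20) with hu
  have h1 : Real.exp (3 / 10) = u ^ 2 := by rw [hu, ← Real.exp_nat_mul]; norm_num
  have h2 : Real.exp (-(9 / 20)) = (u ^ 3)⁻¹ := by
    rw [hu, ← Real.exp_nat_mul, ← Real.exp_neg]; norm_num
  have hlo : 1 ≤ u := Real.one_le_exp (by norm_num)
  have hhi : u ≤ 20 / 17 :=
    (Real.exp_bound_div_one_sub_of_interval (by norm_num) (by norm_num)).trans (by norm_num)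
  -- Clearing denominators, the claim is `u ^ 5 - 2 * u ^ 3 + 1 ≤ 0`; this polynomial is `(u - 1)`
  -- times the quartic here.
  have hq : u ^ 4 + u ^ 3 - u ^ 2 - u - 1 ≤ 0 := by
    have e1 : u ^ 2 ≤ (20 / 17) * u := by nlinarith
    have e2 : u ^ 2 * (u ^ 2 + u - 1) ≤ (20 / 17 * u) * (u ^ 2 + u - 1) := by
      apply mul_le_mul_of_nonneg_right e1; nlinarith
    nlinarith [mul_nonneg (sub_nonneg.2 hlo) (sub_nonneg.2 hhi), sq_nonneg u]
  rw [h1, h2]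
  have h3 : (u ^ 3)⁻¹ ≤ 2 - u ^ 2 := by
    rw [inv_le_iff_one_le_mul₀ (by positivity)]
    nlinarith [mul_nonneg (sub_nonneg.2 hlo) (neg_nonneg.2 hq)]
  linarith

/-- The weight of a pair of points relative to `A`: positive when only the second lies in `A`,
negative when only the first does. -/
noncomputable def pairWeight {Z : Type*} (A : Set Z) (p : Z × Z) : ℝ :=
  3 / 10 * A.indicator (fun _ => (1 : ℝ)) p.2 - 9 / 20 * A.indicator (fun _ => (1 : ℝ)) p.1

/-- Only a pair with exactly one entry in `A` is critical, and there the numerical inequality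
applies; otherwise both orders have the same nonpositive weight. -/
theorem exp_pairWeight_add_swap_le {Z : Type*} (A : Set Z) (p : Z × Z) :
    Real.exp (pairWeight A p) + Real.exp (pairWeight A p.swap) ≤ 2 := by
  have h := exp_add_exp_neg_le_two
  have h' : Real.exp (3 / 10 - 9 / 20) ≤ 1 := Real.exp_le_one_iff.2 (by norm_num)
  obtain ⟨a, b⟩ := p
  by_cases ha : a ∈ A <;> by_cases hb : b ∈ A <;> simp [pairWeight, ha, hb] <;> linarith

/-- Exchange the two entries of the pairs that are selected by `σ`. -/
def swapPairs {Z : Type*} {n : ℕ} (σ : Fin n → Bool) (z : Fin n → Z × Z) : Fin n → Z × Z :=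
  fun i => if σ i then (z i).swap else z i

/-- The swaps act independently on the pairs, so the sum over `σ` factors into `n` sums of two
terms. -/
theorem sum_exp_pairWeight_swapPairs_le {Z : Type*} {n : ℕ} (A : Set Z) (z : Fin n → Z × Z) :
    ∑ σ : Fin n → Bool, Real.exp (∑ i, pairWeight A (swapPairs σ z i)) ≤ 2 ^ n := by
  have h : ∀ σ : Fin n → Bool, Real.exp (∑ i, pairWeight A (swapPairs σ z i)) =
      ∏ i, Real.exp (pairWeight A (if σ i then (z i).swap else z i)) := fun σ => Real.exp_sum _ _
  simp_rw [h]
  have h2 := Finset.prod_univ_sum (fun _ : Fin n => (Finset.univ : Finset Bool))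
    (fun i b => Real.exp (pairWeight A (if b then (z i).swap else z i)))
  rw [Fintype.piFinset_univ] at h2
  rw [← h2]
  calc _ ≤ ∏ _i : Fin n, (2 : ℝ) := by
        refine Finset.prod_le_prod (fun i _ => Finset.sum_nonneg fun _ _ => (Real.exp_pos _).le)
          fun i _ => ?_
        have := exp_pairWeight_add_swap_le A (z i)
        simp
        linarith
    _ = 2 ^ n := by simp

theorem measurePreserving_swapPairs {Z : Type*} [MeasurableSpace Z] {n : ℕ} (P : Measure Z)
    [IsProbabilityMeasure P] (σ : Fin n → Bool) :
    MeasurePreserving (swapPairs σ) (iidLaw n (P.prod P)) (iidLaw n (P.prod P)) := by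
  have hσ : ∀ i, MeasurePreserving (fun p : Z × Z => if σ i then p.swap else p)
      (P.prod P) (P.prod P) := by
    intro i
    cases σ i
    · exact MeasurePreserving.id _
    · exact Measure.measurePreserving_swap
  refine ⟨measurable_pi_lambda _ fun i => (hσ i).measurable.comp (measurable_pi_apply i), ?_⟩
  have : ∀ i, SigmaFinite ((P.prod P).map (fun p : Z × Z => if σ i then p.swap else p)) := by
    intro i; rw [(hσ i).map_eq]; infer_instance
  have h := Measure.pi_map_pi (μ := fun _ : Fin n => P.prod P)
    (f := fun i (p : Z × Z) => if σ i then p.swap else p) fun i => (hσ i).measurable.aemeasurable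
  simp_rw [fun i => (hσ i).map_eq] at h
  exact h

section Uniform

variable {Z : Type*} [Countable Z] [MeasurableSpace Z] [MeasurableSingletonClass Z]

/-- If on every double sample the family `A v`, `v ∈ V`, has at most `G` traces, the weights of
its members are uniformly small with high probability. -/
theorem double_sample_bound {ι : Type*} (V : Set ι) (A : ι → Set Z) (n : ℕ) (P : Measure Z)
    [IsProbabilityMeasure P] (G γ : ℝ)
    (hG : ∀ W : Finset Z, W.card ≤ 2 * n → ∃ R : Finset ι, (R.card : ℝ) ≤ G ∧
      ∀ v ∈ V, ∃ r ∈ R, ∀ x ∈ W, (x ∈ A v ↔ x ∈ A r)) :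
    (iidLaw n (P.prod P)).real {z | ∃ v ∈ V, γ ≤ ∑ i, pairWeight (A v) (z i)} ≤
      G * Real.exp (-γ) := by
  classical
  set Q := iidLaw n (P.prod P)
  set E := {z : Fin n → Z × Z | ∃ v ∈ V, γ ≤ ∑ i, pairWeight (A v) (z i)} with hE
  -- The double sample is fixed and only the swaps are random. Swapping does not change the set of
  -- at most `2 * n` points, so one family `R` serves every `σ`; a union bound over `R` and Markov's
  -- inequality remain.
  have hpt : ∀ z : Fin n → Z × Z,
      ∑ σ : Fin n → Bool, (swapPairs σ ⁻¹' E).indicator (1 : (Fin n → Z × Z) → ℝ) z ≤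
        2 ^ n * (G * Real.exp (-γ)) := by
    intro z
    obtain ⟨R, hRc, hR⟩ := hG
      (Finset.univ.image (fun i => (z i).1) ∪ Finset.univ.image (fun i => (z i).2)) (by
        refine (Finset.card_union_le _ _).trans ?_
        have h1 := Finset.card_image_le (s := Finset.univ) (f := fun i => (z i).1)
        have h2 := Finset.card_image_le (s := Finset.univ) (f := fun i => (z i).2)
        simp only [Finset.card_univ, Fintype.card_fin] at h1 h2
        omega)
    have hσ : ∀ σ : Fin n → Bool,
        (swapPairs σ ⁻¹' E).indicator (1 : (Fin n → Z × Z) → ℝ) z ≤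
          ∑ r ∈ R, Real.exp (∑ i, pairWeight (A r) (swapPairs σ z i)) * Real.exp (-γ) := by
      intro σ
      have hnn : ∀ r ∈ R, 0 ≤ Real.exp (∑ i, pairWeight (A r) (swapPairs σ z i)) *
          Real.exp (-γ) := fun r _ => by positivity
      by_cases hz : z ∈ swapPairs σ ⁻¹' E
      · rw [Set.indicator_of_mem hz]
        obtain ⟨v, hv, hγ⟩ := hz
        obtain ⟨r, hr, hrv⟩ := hR v hv
        refine le_trans ?_ (Finset.single_le_sum hnn hr)
        have hsum : ∑ i, pairWeight (A v) (swapPairs σ z i) =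
            ∑ i, pairWeight (A r) (swapPairs σ z i) := by
          refine Finset.sum_congr rfl fun i _ => ?_
          have h1 := hrv (z i).1 (Finset.mem_union_left _
            (Finset.mem_image_of_mem _ (Finset.mem_univ i)))
          have h2 := hrv (z i).2 (Finset.mem_union_right _
            (Finset.mem_image_of_mem (fun i => (z i).2) (Finset.mem_univ i)))
          cases hb : σ i <;> simp [swapPairs, hb, pairWeight, Set.indicator_apply, h1, h2]
        rw [← hsum, ← Real.exp_add]
        exact Real.one_le_exp (by linarith)
      · rw [Set.indicator_of_notMem hz]
        exact Finset.sum_nonneg hnn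
    calc _ ≤ ∑ σ : Fin n → Bool,
          ∑ r ∈ R, Real.exp (∑ i, pairWeight (A r) (swapPairs σ z i)) * Real.exp (-γ) :=
          Finset.sum_le_sum fun σ _ => hσ σ
      _ = ∑ r ∈ R, (∑ σ : Fin n → Bool,
          Real.exp (∑ i, pairWeight (A r) (swapPairs σ z i))) * Real.exp (-γ) := by
          rw [Finset.sum_comm]; simp_rw [Finset.sum_mul]
      _ ≤ ∑ _r ∈ R, 2 ^ n * Real.exp (-γ) :=
          Finset.sum_le_sum fun r _ => mul_le_mul_of_nonneg_right
            (sum_exp_pairWeight_swapPairs_le (A r) z) (Real.exp_pos _).le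
      _ = R.card * (2 ^ n * Real.exp (-γ)) := by simp
      _ ≤ G * (2 ^ n * Real.exp (-γ)) := by gcongr
      _ = _ := by ring
  have hint : ∀ σ : Fin n → Bool,
      Integrable ((swapPairs σ ⁻¹' E).indicator (1 : (Fin n → Z × Z) → ℝ)) Q := fun σ =>
    (integrable_const (1 : ℝ)).indicator MeasurableSet.of_discrete
  -- Each swap preserves the law, so averaging over all swaps recovers the probability of `E`.
  have hsum : (2 : ℝ) ^ n * Q.real E =
      ∫ z, ∑ σ : Fin n → Bool, (swapPairs σ ⁻¹' E).indicator (1 : (Fin n → Z × Z) → ℝ) z ∂Q := by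
    rw [integral_finsetSum _ fun σ _ => hint σ]
    have hσ : ∀ σ : Fin n → Bool,
        ∫ z, (swapPairs σ ⁻¹' E).indicator (1 : (Fin n → Z × Z) → ℝ) z ∂Q = Q.real E := fun σ => by
      rw [integral_indicator_one MeasurableSet.of_discrete]
      exact (measurePreserving_swapPairs P σ).measureReal_preimage
        (MeasurableSet.of_discrete (s := E)).nullMeasurableSet
    simp [hσ]
  have hle : (2 : ℝ) ^ n * Q.real E ≤ 2 ^ n * (G * Real.exp (-γ)) := by
    rw [hsum]
    refine (integral_mono (integrable_finsetSum _ fun σ _ => hint σ) (integrable_const _)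
      hpt).trans ?_
    simp
  exact le_of_mul_le_mul_left hle (by positivity)

/-- The ghost-sample step: when each bad first sample is confirmed by at least half of the second
samples, passing to double samples costs a factor 2. -/
theorem half_mul_measureReal_le_prod {W : Type*} [Countable W] [MeasurableSpace W]
    [MeasurableSingletonClass W] (μ : Measure W) [IsProbabilityMeasure μ] (B : Set W)
    (E : Set (W × W)) (h : ∀ x ∈ B, 1 / 2 ≤ μ.real {y | (x, y) ∈ E}) :
    1 / 2 * μ.real B ≤ (μ.prod μ).real E := by
  have hE : (μ.prod μ) E = ∫⁻ x, μ (Prod.mk x ⁻¹' E) ∂μ :=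
    Measure.prod_apply MeasurableSet.of_discrete
  have h1 : ENNReal.ofReal (1 / 2) * μ B ≤ (μ.prod μ) E := by
    rw [hE]
    refine le_trans ?_ (mul_meas_ge_le_lintegral (Measurable.of_discrete) (ENNReal.ofReal (1 / 2)))
    gcongr
    intro x hx
    exact (ENNReal.ofReal_le_iff_le_toReal (measure_ne_top _ _)).2 (h x hx)
  have h2 := ENNReal.toReal_mono (measure_ne_top _ _) h1
  rwa [ENNReal.toReal_mul, ENNReal.toReal_ofReal (by norm_num)] at h2

/-- Uniform relative deviation for a family of sets with at most `G` traces on double samples. -/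
theorem uniform_relative_deviation {ι : Type*} (V : Set ι) (A : ι → Set Z) (n : ℕ)
    (P : Measure Z) [IsProbabilityMeasure P] (G ε : ℝ) (hε : 96 ≤ n * ε)
    (hG : ∀ W : Finset Z, W.card ≤ 2 * n → ∃ R : Finset ι, (R.card : ℝ) ≤ G ∧
      ∀ v ∈ V, ∃ r ∈ R, ∀ x ∈ W, (x ∈ A v ↔ x ∈ A r)) :
    (iidLaw n P).real {w | ∃ v ∈ V, 2 * sampleHits (A v) w + n * ε < n * P.real (A v)} ≤
      2 * (G * Real.exp (-(9 / 40 * (n * ε)))) := by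
  -- If `w` is bad and the ghost sample has more than `3 / 4` of its expected hits, the weight
  -- exceeds `9 / 40 * (n * P.real (A v) - 2 * sampleHits (A v) w)`, hence `γ`.
  set γ := 9 / 40 * (n * ε) with hγ
  set E : Set ((Fin n → Z) × (Fin n → Z)) :=
    {p | ∃ v ∈ V, γ ≤ 3 / 10 * sampleHits (A v) p.2 - 9 / 20 * sampleHits (A v) p.1} with hE
  have h1 := double_sample_bound V A n P G γ hG
  have hmp : MeasurePreserving (MeasurableEquiv.arrowProdEquivProdArrow Z Z (Fin n))
      (iidLaw n (P.prod P)) ((iidLaw n P).prod (iidLaw n P)) :=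
    measurePreserving_arrowProdEquivProdArrow Z Z (Fin n) (fun _ => P) (fun _ => P)
  have h2 : (iidLaw n (P.prod P)).real {z | ∃ v ∈ V, γ ≤ ∑ i, pairWeight (A v) (z i)} =
      ((iidLaw n P).prod (iidLaw n P)).real E := by
    rw [← hmp.measureReal_preimage (MeasurableSet.of_discrete (s := E)).nullMeasurableSet]
    congr 1
    ext z
    simp only [hE, Set.mem_preimage, Set.mem_ofPred_eq]
    refine exists_congr fun v => and_congr_right fun _ => ?_
    have : ∑ i, pairWeight (A v) (z i) =
        3 / 10 * sampleHits (A v) (MeasurableEquiv.arrowProdEquivProdArrow Z Z (Fin n) z).2 -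
        9 / 20 * sampleHits (A v) (MeasurableEquiv.arrowProdEquivProdArrow Z Z (Fin n) z).1 := by
      simp only [pairWeight, sampleHits, Finset.mul_sum, ← Finset.sum_sub_distrib]
      rfl
    rw [this]
  rw [h2] at h1
  have h3 := half_mul_measureReal_le_prod (iidLaw n P)
    {w | ∃ v ∈ V, 2 * sampleHits (A v) w + n * ε < n * P.real (A v)} E (by
      rintro w ⟨v, hv, hw⟩
      have hnn := sampleHits_nonneg (A v) w
      have htail := sampleHits_lower_tail n P (A v) (by linarith)
      have hcompl : (iidLaw n P).real
          {w' | sampleHits (A v) w' ≤ 3 / 4 * (n * P.real (A v))}ᶜ =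
            1 - (iidLaw n P).real {w' | sampleHits (A v) w' ≤ 3 / 4 * (n * P.real (A v))} :=
        probReal_compl_eq_one_sub MeasurableSet.of_discrete
      refine le_trans (by linarith) (measureReal_mono (μ := iidLaw n P)
        (s₁ := {w' | sampleHits (A v) w' ≤ 3 / 4 * (n * P.real (A v))}ᶜ) ?_ (by finiteness))
      intro w' hw'
      simp only [Set.mem_compl_iff, Set.mem_ofPred_eq, not_le] at hw'
      refine ⟨v, hv, ?_⟩
      simp only [hγ]
      linarith)
  linarith

/-- Uniform relative deviation for sets that are described by `k` members of a class of finite VC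
dimension. -/
theorem vc_relative_deviation {X : Type*} (C : Set (X → Bool)) (d : ℕ) (hd : classVCDim C ≤ d)
    (k n : ℕ) (hn : 1 ≤ n) (pr : Z → X) (Φ : Z → (Fin k → Bool) → Prop) (P : Measure Z)
    [IsProbabilityMeasure P] (ε : ℝ) (hε : 96 ≤ n * ε) :
    (iidLaw n P).real {w | ∃ v : Fin k → X → Bool, (∀ j, v j ∈ C) ∧
        2 * sampleHits {z | Φ z fun j => v j (pr z)} w + n * ε <
          n * P.real {z | Φ z fun j => v j (pr z)}} ≤
      2 * ((2 * (2 * n : ℝ) ^ d) ^ k * Real.exp (-(9 / 40 * (n * ε)))) := by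
  classical
  refine uniform_relative_deviation {v : Fin k → X → Bool | ∀ j, v j ∈ C}
    (fun v => {z | Φ z fun j => v j (pr z)}) n P _ ε hε fun W hW => ?_
  obtain ⟨R, _, hRc, hR⟩ := exists_trace_representatives C d hd (W.image pr) (2 * n) (by omega)
    (Finset.card_image_le.trans hW)
  -- A trace of the described set is determined by the traces of its `k` members, hence the `k`-th
  -- power of the bound.
  refine ⟨Fintype.piFinset fun _ => R, ?_, fun v hv => ?_⟩
  · rw [Fintype.card_piFinset_const]
    push_cast
    gcongr
    exact_mod_cast hRc
  · choose r hr hrv using fun j => hR (v j) (hv j)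
    refine ⟨r, Fintype.mem_piFinset.2 hr, fun z hz => ?_⟩
    have : (fun j => v j (pr z)) = fun j => r j (pr z) :=
      funext fun j => (hrv j _ (Finset.mem_image_of_mem _ hz)).symm
    simp [this]

end Uniform

/-! ### Deterministic analysis of an execution. -/

section Execution

variable {X : Type*} {n : ℕ}

theorem empErr_eq_sampleHits (x : Fin n → X) (h : X → Bool) (S : Set X) (f : X → Bool) :
    empErr x h S f = sampleHits {a | f a ≠ h a ∧ a ∈ S} x / n := by
  rw [← natCard_eq_sampleHits]; rfl

theorem empErr_samplePts (w : Fin n → X × Bool) (h : X → Bool) (S : Set X) (f : X → Bool) :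
    empErr (samplePts w) h S f = sampleHits {p : X × Bool | f p.1 ≠ h p.1 ∧ p.1 ∈ S} w / n := by
  rw [← natCard_eq_sampleHits]; rfl

theorem trainErr_samplePts (w : Fin n → X × Bool) (c : X → Bool) :
    trainErr (samplePts w) (sampleLabels w) c =
      sampleHits {p : X × Bool | c p.1 ≠ p.2} w / n := by
  rw [← natCard_eq_sampleHits]; rfl

theorem sampleHits_samplePts (w : Fin n → X × Bool) (A : Set X) :
    sampleHits A (samplePts w) = sampleHits {p : X × Bool | p.1 ∈ A} w := by
  rw [← natCard_eq_sampleHits, ← natCard_eq_sampleHits]; rfl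

theorem empErr_nonneg (x : Fin n → X) (h : X → Bool) (S : Set X) (f : X → Bool) :
    0 ≤ empErr x h S f := by
  unfold empErr; positivity

theorem sampleHits_union_le (A B : Set X) (x : Fin n → X) :
    sampleHits (A ∪ B) x ≤ sampleHits A x + sampleHits B x := by
  classical
  rw [sampleHits, sampleHits, sampleHits, ← Finset.sum_add_distrib]
  refine Finset.sum_le_sum fun i _ => ?_
  by_cases hA : x i ∈ A <;> by_cases hB : x i ∈ B <;> simp [hA, hB]

theorem empErr_le_trainErr_add (w : Fin n → X × Bool) (h f : X → Bool) :
    empErr (samplePts w) h Set.univ f ≤ trainErr (samplePts w) (sampleLabels w) h +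
      trainErr (samplePts w) (sampleLabels w) f := by
  rw [empErr_samplePts, trainErr_samplePts, trainErr_samplePts, ← add_div]
  refine div_le_div_of_nonneg_right ?_ n.cast_nonneg
  refine le_trans (sampleHits_mono ?_ w) (sampleHits_union_le _ _ w)
  rintro p ⟨hp, -⟩
  by_cases hh : h p.1 = p.2
  · exact Or.inr fun hf => hp (hf.trans hh.symm)
  · exact Or.inl hh

theorem rejectronSet_zero (h : X → Bool) (c : ℕ → X → Bool) : rejectronSet h c 0 = Set.univ := by
  ext; simp [rejectronSet]

theorem rejectronSet_succ (h : X → Bool) (c : ℕ → X → Bool) (t : ℕ) :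
    rejectronSet h c (t + 1) = rejectronSet h c t ∩ {x | h x = c t x} := by
  ext x
  exact Nat.forall_lt_succ_right (p := fun i => h x = c i x)

/-- The disagreement region of round `t` is exactly what is removed between the selected sets `t`
and `t + 1`, so these regions are disjoint. -/
theorem sum_empErr_rejectronSet_le_one (x : Fin n → X) (h : X → Bool) (c : ℕ → X → Bool) (T : ℕ) :
    ∑ t ∈ Finset.range T, empErr x h (rejectronSet h c t) (c t) ≤ 1 := by
  have key : ∑ t ∈ Finset.range T, sampleHits {a | c t a ≠ h a ∧ a ∈ rejectronSet h c t} x +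
      sampleHits (rejectronSet h c T) x ≤ n := by
    induction T with
    | zero => simpa using sampleHits_le _ x
    | succ T ih =>
      rw [Finset.sum_range_succ]
      have : sampleHits {a | c T a ≠ h a ∧ a ∈ rejectronSet h c T} x +
          sampleHits (rejectronSet h c (T + 1)) x = sampleHits (rejectronSet h c T) x := by
        classical
        rw [rejectronSet_succ, sampleHits, sampleHits, sampleHits, ← Finset.sum_add_distrib]
        refine Finset.sum_congr rfl fun i _ => ?_
        by_cases h1 : x i ∈ rejectronSet h c T <;> by_cases h2 : c T (x i) = h (x i) <;>
          simp [h1, h2, eq_comm (a := h (x i))]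
      linarith
  simp_rw [empErr_eq_sampleHits, ← Finset.sum_div]
  refine div_le_one_of_le₀ ?_ n.cast_nonneg
  linarith [sampleHits_nonneg (rejectronSet h c T) x]

theorem sampleHits_compl_rejectronSet_le (x : Fin n → X) (h : X → Bool) (c : ℕ → X → Bool)
    (T : ℕ) :
    sampleHits (rejectronSet h c T)ᶜ x / n ≤
      ∑ t ∈ Finset.range T, empErr x h Set.univ (c t) := by
  induction T with
  | zero => simp [rejectronSet_zero, sampleHits]
  | succ T ih =>
    rw [Finset.sum_range_succ, empErr_eq_sampleHits]
    refine le_trans ?_ (add_le_add_left ih _)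
    rw [← add_div]
    refine div_le_div_of_nonneg_right ?_ n.cast_nonneg
    refine le_trans (sampleHits_mono ?_ x) (sampleHits_union_le _ _ x)
    rw [rejectronSet_succ, Set.compl_inter]
    refine Set.union_subset_union_right _ fun a ha => ⟨fun he => ha he.symm, trivial⟩

/-- The rounds in which Rejectron does not stop are paid for by the rejected test examples. -/
theorem rounds_mul_add_le_one (x xt : Fin n → X) (ε Λ : ℝ) (h : X → Bool) (c : ℕ → X → Bool)
    (T : ℕ) (hT : ∀ t < T, ¬ RejectronStops x xt ε Λ h c t) :
    T * ε + Λ * ∑ t ∈ Finset.range T, empErr x h Set.univ (c t) ≤ 1 := by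
  refine le_trans ?_ (sum_empErr_rejectronSet_le_one xt h c T)
  have : (T : ℝ) * ε = ∑ _t ∈ Finset.range T, ε := by simp
  rw [this, Finset.mul_sum, ← Finset.sum_add_distrib]
  refine Finset.sum_le_sum fun t ht => ?_
  have := hT t (Finset.mem_range.1 ht)
  simp only [RejectronStops, rejectronScore, not_le] at this
  linarith

theorem rounds_mul_le_one (x xt : Fin n → X) (ε Λ : ℝ) (hΛ : 0 ≤ Λ) (h : X → Bool)
    (c : ℕ → X → Bool) (T : ℕ) (hT : ∀ t < T, ¬ RejectronStops x xt ε Λ h c t) :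
    T * ε ≤ 1 := by
  have h1 := rounds_mul_add_le_one x xt ε Λ h c T hT
  have h2 : 0 ≤ Λ * ∑ t ∈ Finset.range T, empErr x h Set.univ (c t) :=
    mul_nonneg hΛ (Finset.sum_nonneg fun _ _ => empErr_nonneg _ _ _ _)
  linarith

theorem exists_rejectronStops (x xt : Fin n → X) (ε Λ : ℝ) (hε : 0 < ε) (hΛ : 0 ≤ Λ)
    (h : X → Bool) (c : ℕ → X → Bool) : ∃ T, RejectronStops x xt ε Λ h c T := by
  by_contra! hno
  obtain ⟨T, hT⟩ := exists_nat_gt (1 / ε)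
  have := rounds_mul_le_one x xt ε Λ hΛ h c T fun t _ => hno t
  rw [div_lt_iff₀ hε] at hT
  linarith

/-- `C` may be infinite, but a score is determined by two counts that are at most `n`, so only
finitely many values occur. -/
theorem exists_max_rejectronScore (C : Set (X → Bool)) (hC : C.Nonempty) (x xt : Fin n → X)
    (Λ : ℝ) (h : X → Bool) (S : Set X) :
    ∃ c ∈ C, ∀ g ∈ C, rejectronScore x xt Λ h S g ≤ rejectronScore x xt Λ h S c := by
  have hfin : (rejectronScore x xt Λ h S '' C).Finite := by
    refine ((Set.finite_Iic n).image2 (fun a b : ℕ => (a : ℝ) / n - Λ * ((b : ℝ) / n))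
      (Set.finite_Iic n)).subset ?_
    rintro _ ⟨g, -, rfl⟩
    have hcard : ∀ p : Fin n → Prop, Nat.card {i // p i} ≤ n := fun p => by
      simpa using Finite.card_subtype_le p
    exact ⟨_, hcard _, _, hcard _, rfl⟩
  obtain ⟨_, ⟨c, hc, rfl⟩, hmax⟩ := Set.exists_max_image _ id hfin (hC.image _)
  exact ⟨c, hc, fun g hg => hmax _ ⟨g, hg, rfl⟩⟩

theorem exists_rejectronChoices (C : Set (X → Bool)) (hC : C.Nonempty) (x xt : Fin n → X)
    (Λ : ℝ) (h : X → Bool) : ∃ c : ℕ → X → Bool, ∀ t, IsRejectronChoice C x xt Λ h c t := by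
  choose pick hpick hmax using exists_max_rejectronScore C hC x xt Λ h
  -- Admissibility of a choice refers to the set built from earlier choices; recursing on the sets
  -- instead of the choices avoids this circularity.
  let sel : ℕ → Set X := fun t => Nat.rec Set.univ (fun _ S => S ∩ {x | h x = pick S x}) t
  have hsel : ∀ t, rejectronSet h (fun t => pick (sel t)) t = sel t := by
    intro t
    induction t with
    | zero => exact rejectronSet_zero _ _
    | succ t ih => rw [rejectronSet_succ, ih]
  refine ⟨fun t => pick (sel t), fun t => ⟨hpick _, ?_⟩⟩
  rw [hsel t]
  exact hmax _

theorem exists_rejectronOutput (C : Set (X → Bool)) (hC : C.Nonempty)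
    (erm : (Fin n → X) → (Fin n → Bool) → X → Bool) (x : Fin n → X) (y : Fin n → Bool)
    (xt : Fin n → X) (ε Λ : ℝ) (hε : 0 < ε) (hΛ : 0 ≤ Λ) :
    ∃ S, IsRejectronOutput C erm x y xt ε Λ S := by
  classical
  obtain ⟨c, hc⟩ := exists_rejectronChoices C hC x xt Λ (erm x y)
  have hT := exists_rejectronStops x xt ε Λ hε hΛ (erm x y) c
  exact ⟨_, c, Nat.find hT, fun t _ => hc t, fun t ht => Nat.find_min hT ht, Nat.find_spec hT, rfl⟩

/-- A selected set that is reached within `M` rounds is described by `h` and `M` members of `C`. -/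
theorem exists_description_rejectronSet (C : Set (X → Bool)) (h : X → Bool) (hh : h ∈ C)
    (c : ℕ → X → Bool) (T M : ℕ) (hTM : T ≤ M) (hc : ∀ t < T, c t ∈ C) :
    ∃ v : Fin (M + 1) → X → Bool, (∀ j, v j ∈ C) ∧ v 0 = h ∧
      ∀ x, x ∈ rejectronSet h c T ↔ ∀ i : Fin M, v 0 x = v i.succ x := by
  -- Unused slots are filled with `h`, whose equation is vacuous, so that the number of members no
  -- longer depends on `T`.
  refine ⟨Fin.cons h fun i => if (i : ℕ) < T then c i else h, fun j => ?_, rfl, fun x => ?_⟩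
  · refine Fin.cases hh (fun i => ?_) j
    by_cases hi : (i : ℕ) < T
    · simpa [hi] using hc i hi
    · simpa [hi] using hh
  · simp only [Fin.cons_zero, Fin.cons_succ]
    constructor
    · intro hx i
      by_cases hi : (i : ℕ) < T
      · simpa [hi] using hx i hi
      · simp [hi]
    · intro hx i hi
      simpa [hi] using hx ⟨i, hi.trans_le hTM⟩

end Execution

/-! ### Numerical bounds and the two guarantees. -/

theorem sample_size_bounds (d n : ℕ) (hn : 1 ≤ n) (δ ε : ℝ) (hδ : 0 < δ) (hδ1 : δ < 1)
    (hε : 4 * √((d * Real.log (2 * n) + Real.log (24 / δ)) / n) ≤ ε) (hε2 : ε ≤ 1 / 2) :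
    0 < ε ∧ 96 ≤ n * ε ∧ Real.exp (-(n * (ε ^ 2 / 4))) ≤ δ / 24 ∧
    2 * ((2 * (2 * n : ℝ) ^ d) ^ (⌊1 / ε⌋₊ + 1) * Real.exp (-(9 / 40 * (n * ε)))) ≤ δ / 24 := by
  have hn0 : (1 : ℝ) ≤ n := by exact_mod_cast hn
  set D := d * Real.log (2 * n) with hD
  set l := Real.log (24 / δ) with hl
  have hD0 : 0 ≤ D := mul_nonneg d.cast_nonneg (Real.log_nonneg (by linarith))
  have hl3 : 3 ≤ l := by
    rw [hl, Real.le_log_iff_exp_le (by positivity)]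
    have h1 : Real.exp 3 = Real.exp 1 ^ 3 := by rw [← Real.exp_nat_mul]; norm_num
    have h2 : Real.exp 1 ^ 3 ≤ 2.8 ^ 3 := by
      have := Real.exp_one_lt_d9
      gcongr
      linarith
    have h3 : 24 ≤ 24 / δ := by rw [le_div_iff₀ hδ]; linarith
    norm_num at h2
    linarith
  have hexp : Real.exp (-l) = δ / 24 := by
    rw [hl, ← Real.log_inv, Real.exp_log (by positivity), inv_div]
  have hpos : 0 < (D + l) / n := by positivity
  have hε0 : 0 < ε := lt_of_lt_of_le (by positivity) hε
  have hsq : 16 * (D + l) ≤ n * ε ^ 2 := by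
    have h1 : (4 * √((D + l) / n)) ^ 2 ≤ ε ^ 2 := by gcongr
    rw [mul_pow, Real.sq_sqrt hpos.le] at h1
    have h2 := mul_le_mul_of_nonneg_left h1 (zero_le_one.trans hn0)
    have h3 : (n : ℝ) * (4 ^ 2 * ((D + l) / n)) = 16 * (D + l) := by field_simp; ring
    linarith
  have h96 : 96 ≤ n * ε := by
    have : (n : ℝ) * ε ^ 2 ≤ (n * ε) * (1 / 2) := by rw [sq, ← mul_assoc]; gcongr
    linarith
  refine ⟨hε0, h96, ?_, ?_⟩
  · rw [← hexp]
    exact Real.exp_le_exp.2 (by linarith)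
  · set r := 1 / ε with hr
    have hr2 : 2 ≤ r := by rw [hr, le_div_iff₀ hε0]; linarith
    have hM : ((⌊r⌋₊ : ℕ) : ℝ) ≤ r := Nat.floor_le (by linarith)
    have hnε : 16 * (D + l) * r ≤ n * ε := by
      have h1 := mul_le_mul_of_nonneg_right hsq (by linarith : 0 ≤ r)
      have h2 : (n : ℝ) * ε ^ 2 * r = n * ε := by rw [hr]; field_simp
      linarith
    have hbase : 2 * (2 * n : ℝ) ^ d = Real.exp (Real.log 2 + D) := by
      rw [Real.exp_add, Real.exp_log two_pos, hD, Real.exp_nat_mul, Real.exp_log (by linarith)]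
    have hlog2 : 0 ≤ Real.log 2 := Real.log_nonneg one_le_two
    have hlog2' := Real.log_two_lt_d9
    rw [← hexp, hbase, ← Real.exp_nat_mul, ← Real.exp_add]
    nth_rewrite 1 [← Real.exp_log (two_pos : (0 : ℝ) < 2)]
    rw [← Real.exp_add]
    refine Real.exp_le_exp.2 ?_
    -- From `r ≥ 2` one gets `⌊r⌋₊ + 1 ≤ 3 / 2 * r`. The cost, about `3 / 2 * r * D`, is beaten by
    -- `9 / 40 * 16 = 18 / 5` times `r * (D + l)`.
    have hk : ((⌊r⌋₊ + 1 : ℕ) : ℝ) * (Real.log 2 + D) ≤ 3 / 2 * r * (7 / 10 + D) := by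
      push_cast
      gcongr <;> linarith
    have hrD : 0 ≤ r * D := by positivity
    nlinarith [mul_le_mul_of_nonneg_right hr2 (by linarith : 0 ≤ l),
      mul_le_mul_of_nonneg_left hl3 (by linarith : 0 ≤ r)]

theorem one_sub_le_measureReal_of_compl_subset {W : Type*} [MeasurableSpace W]
    [DiscreteMeasurableSpace W] (Q : Measure W) [IsProbabilityMeasure Q] (good bad : Set W)
    (δ : ℝ) (hbad : Q.real bad ≤ δ) (h : ∀ w, w ∉ bad → w ∈ good) : 1 - δ ≤ Q.real good := by
  have h1 : Q.real badᶜ = 1 - Q.real bad := probReal_compl_eq_one_sub MeasurableSet.of_discrete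
  have h2 : Q.real badᶜ ≤ Q.real good := measureReal_mono h (by finiteness)
  linarith

theorem one_sub_le_measureReal_of_forall {W : Type*} [MeasurableSpace W] (Q : Measure W)
    [IsProbabilityMeasure Q] (good : Set W) (δ : ℝ) (hδ : 0 ≤ δ) (h : ∀ w, w ∈ good) :
    1 - δ ≤ Q.real good := by
  rw [Set.eq_univ_of_forall h, probReal_univ]
  linarith

theorem selErr_le_clfErr_add {X : Type*} [MeasurableSpace X] (D : Measure (X × Bool)) [IsProbabilityMeasure D]
    (h f : X → Bool) (S : Set X) :
    selErr D h S ≤ clfErr D f + D.real {p | f p.1 ≠ h p.1 ∧ p.1 ∈ S} := by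
  refine le_trans (measureReal_mono ?_ (by finiteness)) (measureReal_union_le _ _)
  rintro p ⟨hp, hS⟩
  by_cases hf : f p.1 = p.2
  · exact Or.inr ⟨fun h' => hp (h'.symm.trans hf), hS⟩
  · exact Or.inl hf

/-- The stopping rule bounds the empirical disagreement of the output with any `f ∈ C`. -/
theorem empErr_output_le {X : Type*} {n : ℕ} (C : Set (X → Bool)) (f h : X → Bool) (hf : f ∈ C)
    (w : Fin n → X × Bool) (xt : Fin n → X) (ε Λ : ℝ) (hΛ : 0 ≤ Λ)
    (hh : trainErr (samplePts w) (sampleLabels w) h ≤ trainErr (samplePts w) (sampleLabels w) f)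
    (c : ℕ → X → Bool) (T : ℕ) (hc : IsRejectronChoice C (samplePts w) xt Λ h c T)
    (hT : RejectronStops (samplePts w) xt ε Λ h c T) :
    empErr xt h (rejectronSet h c T) f ≤
      ε + Λ * (2 * trainErr (samplePts w) (sampleLabels w) f) := by
  have h1 := (hc.2 f hf).trans hT
  simp only [rejectronScore] at h1
  have h2 := mul_le_mul_of_nonneg_left
    ((empErr_le_trainErr_add w h f).trans (add_le_add_left hh _)) hΛ
  linarith

section Guarantees

variable {X : Type*} [Countable X] [MeasurableSpace X] [MeasurableSingletonClass X]

theorem rejectron_test_error (C : Set (X → Bool)) (d : ℕ) (hd : classVCDim C = (d : ℕ∞))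
    (n : ℕ) (hn : 1 ≤ n) (erm : (Fin n → X) → (Fin n → Bool) → X → Bool) (herm : IsERM C erm)
    (μ μt : Measure (X × Bool)) [IsProbabilityMeasure μ] [IsProbabilityMeasure μt]
    (δ ε : ℝ) (hδ : 0 < δ) (hδ1 : δ < 1)
    (hε : 4 * √((d * Real.log (2 * n) + Real.log (24 / δ)) / n) ≤ ε)
    (f : X → Bool) (hf : f ∈ C) (Λ : ℝ) (hΛ : 0 ≤ Λ) :
    1 - δ ≤ ((iidLaw n μ).prod (iidLaw n μt)).real
      {w | ∀ S, IsRejectronOutput C erm (samplePts w.1) (sampleLabels w.1)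
          (samplePts w.2) ε Λ S →
        selErr μt (erm (samplePts w.1) (sampleLabels w.1)) S ≤
          8 * Λ * clfErr μ f + 2 * clfErr μt f + Λ * ε ^ 2 + 3 * ε} := by
  have hp : 0 ≤ clfErr μ f := measureReal_nonneg
  have hpt : 0 ≤ clfErr μt f := measureReal_nonneg
  by_cases hε2 : ε ≤ 1 / 2
  swap
  -- For `ε > 1 / 2` the term `3 * ε` already exceeds 1.
  · refine one_sub_le_measureReal_of_forall _ _ δ hδ.le fun w S _ => ?_
    have h1 : selErr μt (erm (samplePts w.1) (sampleLabels w.1)) S ≤ 1 := measureReal_le_one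
    have h2 : 0 ≤ Λ * clfErr μ f := mul_nonneg hΛ hp
    have h3 : 0 ≤ Λ * ε ^ 2 := mul_nonneg hΛ (sq_nonneg ε)
    linarith
  obtain ⟨hε0, h96, htail, hvc⟩ := sample_size_bounds d n hn δ ε hδ hδ1 hε hε2
  have hn0 : (0 : ℝ) < n := by exact_mod_cast hn
  set M := ⌊1 / ε⌋₊
  let Φ : X × Bool → (Fin (M + 1) → Bool) → Prop :=
    fun z b => f z.1 ≠ b 0 ∧ ∀ i : Fin M, b 0 = b i.succ
  let B1 : Set (Fin n → X × Bool) :=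
    {w | n * (2 * clfErr μ f + ε ^ 2 / 4) ≤ sampleHits {p | f p.1 ≠ p.2} w}
  -- The event ranges over all tuples in `C`, so it depends on the test sample alone although `h`
  -- and the choices depend on both samples.
  let B2 : Set (Fin n → X × Bool) := {w | ∃ v : Fin (M + 1) → X → Bool, (∀ j, v j ∈ C) ∧
    2 * sampleHits {z | Φ z fun j => v j z.1} w + n * ε <
      n * μt.real {z | Φ z fun j => v j z.1}}
  have hB1 : (iidLaw n μ).real B1 ≤ δ / 24 := (sampleHits_upper_tail n μ _ _).trans htail
  have hB2 : (iidLaw n μt).real B2 ≤ δ / 24 :=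
    (vc_relative_deviation C d hd.le (M + 1) n hn Prod.fst Φ μt ε h96).trans hvc
  refine one_sub_le_measureReal_of_compl_subset _ _
    (B1 ×ˢ Set.univ ∪ Set.univ ×ˢ B2) δ ?_ ?_
  · refine (measureReal_union_le _ _).trans ?_
    rw [measureReal_prod_prod, measureReal_prod_prod, probReal_univ, probReal_univ]
    linarith
  rintro ⟨w, wt⟩ hw S ⟨c, T, hc, hcont, hlast, rfl⟩
  have hw1 : w ∉ B1 := fun h => hw (Or.inl ⟨h, trivial⟩)
  have hw2 : wt ∉ B2 := fun h => hw (Or.inr ⟨trivial, h⟩)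
  simp only at hc hcont hlast ⊢
  obtain ⟨hhC, hmin⟩ := herm (samplePts w) (sampleLabels w)
  set h := erm (samplePts w) (sampleLabels w)
  have hTM : T ≤ M := Nat.le_floor (by
    rw [le_div_iff₀ hε0]
    exact rounds_mul_le_one _ _ ε Λ hΛ h c T hcont)
  obtain ⟨v, hvC, hv0, hv⟩ :=
    exists_description_rejectronSet C h hhC c T M hTM fun t ht => (hc t ht.le).1
  have hset : {z : X × Bool | Φ z fun j => v j z.1} =
      {p | f p.1 ≠ h p.1 ∧ p.1 ∈ rejectronSet h c T} := by
    ext z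
    simp only [Φ, Set.mem_ofPred_eq, hv, hv0]
  have hdev : n * μt.real {p : X × Bool | f p.1 ≠ h p.1 ∧ p.1 ∈ rejectronSet h c T} ≤
      2 * sampleHits {p : X × Bool | f p.1 ≠ h p.1 ∧ p.1 ∈ rejectronSet h c T} wt + n * ε := by
    rw [← hset]
    exact not_lt.1 fun hlt => hw2 ⟨v, hvC, hlt⟩
  have hemp := empErr_output_le C f h hf w (samplePts wt) ε Λ hΛ (hmin f hf) c T
    (hc T le_rfl) hlast
  have htrain : trainErr (samplePts w) (sampleLabels w) f ≤ 2 * clfErr μ f + ε ^ 2 / 4 := by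
    rw [trainErr_samplePts, div_le_iff₀ hn0, mul_comm]
    exact (not_le.1 hw1).le
  have hdev' : μt.real {p : X × Bool | f p.1 ≠ h p.1 ∧ p.1 ∈ rejectronSet h c T} ≤
      2 * empErr (samplePts wt) h (rejectronSet h c T) f + ε := by
    rw [empErr_samplePts]
    refine le_of_mul_le_mul_left (hdev.trans_eq ?_) hn0
    field_simp
  have hsel := selErr_le_clfErr_add μt h f (rejectronSet h c T)
  have hmul := mul_le_mul_of_nonneg_left htrain hΛ
  -- The sum is `clfErr μt f + 2 * (ε + 2 * Λ * (2 * clfErr μ f + ε ^ 2 / 4)) + ε`; the second copy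
  -- of `clfErr μt f` in the goal is slack.
  linarith

theorem rejectron_rejection_rate (C : Set (X → Bool)) (d : ℕ) (hd : classVCDim C = (d : ℕ∞))
    (n : ℕ) (hn : 1 ≤ n) (erm : (Fin n → X) → (Fin n → Bool) → X → Bool) (herm : IsERM C erm)
    (μ : Measure (X × Bool)) [IsProbabilityMeasure μ] (δ ε : ℝ) (hδ : 0 < δ) (hδ1 : δ < 1)
    (hε : 4 * √((d * Real.log (2 * n) + Real.log (24 / δ)) / n) ≤ ε) (Λ : ℝ) (hΛ : 0 < Λ) :
    1 - δ ≤ (iidLaw n μ).real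
      {w | ∀ (xt : Fin n → X) (S : Set X),
        IsRejectronOutput C erm (samplePts w) (sampleLabels w) xt ε Λ S →
        rejRate μ S ≤ 2 / Λ + 2 * ε} := by
  have hΛ2 : 0 ≤ 2 / Λ := by positivity
  by_cases hε2 : ε ≤ 1 / 2
  swap
  · refine one_sub_le_measureReal_of_forall _ _ δ hδ.le fun w xt S _ => ?_
    have h1 : rejRate μ S ≤ 1 := measureReal_le_one
    linarith
  obtain ⟨hε0, h96, -, hvc⟩ := sample_size_bounds d n hn δ ε hδ hδ1 hε hε2
  have hn0 : (0 : ℝ) < n := by exact_mod_cast hn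
  set M := ⌊1 / ε⌋₊
  -- The rejected region is described, not the selected one. Uniformity over descriptions also gives
  -- uniformity over `xt`.
  let Φ : X × Bool → (Fin (M + 1) → Bool) → Prop := fun _ b => ¬ ∀ i : Fin M, b 0 = b i.succ
  let B : Set (Fin n → X × Bool) := {w | ∃ v : Fin (M + 1) → X → Bool, (∀ j, v j ∈ C) ∧
    2 * sampleHits {z | Φ z fun j => v j z.1} w + n * ε <
      n * μ.real {z | Φ z fun j => v j z.1}}
  have hB : (iidLaw n μ).real B ≤ δ / 24 :=
    (vc_relative_deviation C d hd.le (M + 1) n hn Prod.fst Φ μ ε h96).trans hvc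
  refine one_sub_le_measureReal_of_compl_subset _ _ B δ (by linarith) ?_
  rintro w hw xt S ⟨c, T, hc, hcont, hlast, rfl⟩
  obtain ⟨hhC, -⟩ := herm (samplePts w) (sampleLabels w)
  set h := erm (samplePts w) (sampleLabels w)
  have hTM : T ≤ M := Nat.le_floor (by
    rw [le_div_iff₀ hε0]
    exact rounds_mul_le_one _ _ ε Λ hΛ.le h c T hcont)
  obtain ⟨v, hvC, -, hv⟩ :=
    exists_description_rejectronSet C h hhC c T M hTM fun t ht => (hc t ht.le).1
  have hset : {z : X × Bool | Φ z fun j => v j z.1} = {p | p.1 ∈ (rejectronSet h c T)ᶜ} := by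
    ext z
    simp only [Φ, Set.mem_ofPred_eq, Set.mem_compl_iff, hv]
  have hdev : n * μ.real {p : X × Bool | p.1 ∈ (rejectronSet h c T)ᶜ} ≤
      2 * sampleHits {p : X × Bool | p.1 ∈ (rejectronSet h c T)ᶜ} w + n * ε := by
    rw [← hset]
    exact not_lt.1 fun hlt => hw ⟨v, hvC, hlt⟩
  rw [← sampleHits_samplePts] at hdev
  have hemp := sampleHits_compl_rejectronSet_le (samplePts w) h c T
  have hround := rounds_mul_add_le_one _ _ ε Λ h c T hcont
  have hTε : 0 ≤ T * ε := by positivity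
  have hsum : ∑ t ∈ Finset.range T, empErr (samplePts w) h Set.univ (c t) ≤ 1 / Λ := by
    rw [le_div_iff₀ hΛ]
    linarith
  have hdev' : rejRate μ (rejectronSet h c T) ≤
      2 * (sampleHits (rejectronSet h c T)ᶜ (samplePts w) / n) + ε := by
    refine le_of_mul_le_mul_left (hdev.trans_eq ?_) hn0
    field_simp
  have : 2 / Λ = 2 * (1 / Λ) := by ring
  linarith

/-- With `Λ` the reciprocal of `√(8 * η + ε ^ 2)`, the error term equals this root and `2 / Λ` is
twice it; subadditivity of the square root does the rest. -/
theorem balanced_bounds (η ε Λ : ℝ) (hη : 0 ≤ η) (hε : 0 < ε)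
    (hΛ : Λ = √(1 / (8 * η + ε ^ 2))) :
    0 < Λ ∧ 8 * Λ * η + Λ * ε ^ 2 ≤ 2 * √(2 * η) + ε ∧ 2 / Λ ≤ 4 * √(2 * η) + 2 * ε := by
  have hs : 0 < 8 * η + ε ^ 2 := by positivity
  have hs' : 0 < √(8 * η + ε ^ 2) := Real.sqrt_pos.2 hs
  have hle : √(8 * η + ε ^ 2) ≤ 2 * √(2 * η) + ε := by
    rw [Real.sqrt_le_iff]
    refine ⟨by positivity, ?_⟩
    have h1 := Real.sq_sqrt (by positivity : 0 ≤ 2 * η)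
    have h2 : 0 ≤ √(2 * η) * ε := by positivity
    nlinarith
  have hΛ' : Λ = 1 / √(8 * η + ε ^ 2) := by rw [hΛ, Real.sqrt_div zero_le_one, Real.sqrt_one]
  refine ⟨by rw [hΛ']; positivity, ?_, ?_⟩
  · have : 8 * Λ * η + Λ * ε ^ 2 = √(8 * η + ε ^ 2) := by
      rw [show 8 * Λ * η + Λ * ε ^ 2 = (8 * η + ε ^ 2) * Λ by ring, hΛ', mul_one_div,
        Real.div_sqrt]
    linarith
  · have : 2 / Λ = 2 * √(8 * η + ε ^ 2) := by rw [hΛ']; field_simp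
    linarith

end Guarantees

theorem mainTheorem6 {X : Type*} [Countable X] [MeasurableSpace X] [MeasurableSingletonClass X]
    (C : Set (X → Bool)) (d : ℕ) (hd : classVCDim C = (d : ℕ∞))
    (n : ℕ) (hn : 1 ≤ n)
    (erm : (Fin n → X) → (Fin n → Bool) → X → Bool) (herm : IsERM C erm) :
    -- Rejectron is well defined: maximizers exist and every execution halts
    (∀ ε Λ : ℝ, 0 < ε → 0 ≤ Λ → ∀ (x : Fin n → X) (y : Fin n → Bool) (xt : Fin n → X),
      (∃ S, IsRejectronOutput C erm x y xt ε Λ S) ∧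
      ∀ c : ℕ → X → Bool, (∀ t, IsRejectronChoice C x xt Λ (erm x y) c t) →
        ∃ T, RejectronStops x xt ε Λ (erm x y) c T) ∧
    -- the trade-off between errors and rejections
    (∀ (μ μt : Measure (X × Bool)) [IsProbabilityMeasure μ] [IsProbabilityMeasure μt]
      (δ ε : ℝ), 0 < δ → δ < 1 →
      4 * √((d * Real.log (2 * n) + Real.log (24 / δ)) / n) ≤ ε →
      (∀ f ∈ C, ∀ Λ : ℝ, 0 ≤ Λ →
        1 - δ ≤ ((iidLaw n μ).prod (iidLaw n μt)).real
          {w | ∀ S, IsRejectronOutput C erm (samplePts w.1) (sampleLabels w.1)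
              (samplePts w.2) ε Λ S →
            selErr μt (erm (samplePts w.1) (sampleLabels w.1)) S ≤
              8 * Λ * clfErr μ f + 2 * clfErr μt f + Λ * ε ^ 2 + 3 * ε}) ∧
      (∀ Λ : ℝ, 0 < Λ →
        1 - δ ≤ (iidLaw n μ).real
          {w | ∀ (xt : Fin n → X) (S : Set X),
            IsRejectronOutput C erm (samplePts w) (sampleLabels w) xt ε Λ S →
            rejRate μ S ≤ 2 / Λ + 2 * ε})) ∧
    -- the guarantee for the balanced choice of the parameters
    (∀ (μ μt : Measure (X × Bool)) [IsProbabilityMeasure μ] [IsProbabilityMeasure μt]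
      (δ η ηt : ℝ), 0 < δ → δ < 1 → 0 ≤ η → η < 1 → 0 ≤ ηt → ηt < 1 →
      (∃ f ∈ C, clfErr μ f ≤ η ∧ clfErr μt f ≤ ηt) →
      ∀ εs Λs : ℝ, εs = 4 * √((d * Real.log (2 * n) + Real.log (48 / δ)) / n) →
        Λs = √(1 / (8 * η + εs ^ 2)) →
        1 - δ ≤ ((iidLaw n μ).prod (iidLaw n μt)).real
          {w | ∀ S, IsRejectronOutput C erm (samplePts w.1) (sampleLabels w.1)
              (samplePts w.2) εs Λs S →
            selErr μt (erm (samplePts w.1) (sampleLabels w.1)) S ≤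
                2 * √(2 * η) + 2 * ηt + 4 * εs ∧
              rejRate μ S ≤ 4 * √(2 * η) + 4 * εs}) := by
  refine ⟨fun ε Λ hε hΛ x y xt => ⟨?_, fun c _ => ?_⟩, ?_, ?_⟩
  · exact exists_rejectronOutput C ⟨_, (herm x y).1⟩ erm x y xt ε Λ hε hΛ
  · exact exists_rejectronStops x xt ε Λ hε hΛ (erm x y) c
  · intro μ μt _ _ δ ε hδ hδ1 hε
    exact ⟨fun f hf Λ hΛ =>
        rejectron_test_error C d hd n hn erm herm μ μt δ ε hδ hδ1 hε f hf Λ hΛ,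
      fun Λ hΛ => rejectron_rejection_rate C d hd n hn erm herm μ δ ε hδ hδ1 hε Λ hΛ⟩
  · rintro μ μt _ _ δ η ηt hδ hδ1 hη - - - ⟨f, hf, hfη, hfηt⟩ ε Λ hε hΛ
    have hn0 : (1 : ℝ) ≤ n := by exact_mod_cast hn
    have hε0 : 0 < ε := by
      have h1 : 0 ≤ d * Real.log (2 * n) :=
        mul_nonneg d.cast_nonneg (Real.log_nonneg (by linarith))
      have h2 : 0 < Real.log (48 / δ) := Real.log_pos (by rw [lt_div_iff₀ hδ]; linarith)
      rw [hε]
      positivity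
    obtain ⟨hΛ0, herr, hrej⟩ := balanced_bounds η ε Λ hη hε0 hΛ
    -- Each guarantee is used with confidence `δ / 2`, which turns 24 into 48.
    have hε' : 4 * √((d * Real.log (2 * n) + Real.log (24 / (δ / 2))) / n) ≤ ε := by
      rw [hε, show 24 / (δ / 2) = 48 / δ by field_simp; norm_num]
    have hA := rejectron_test_error C d hd n hn erm herm μ μt (δ / 2) ε (by linarith)
      (by linarith) hε' f hf Λ hΛ0.le
    have hB := rejectron_rejection_rate C d hd n hn erm herm μ (δ / 2) ε (by linarith)
      (by linarith) hε' Λ hΛ0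
    set A := {w : (Fin n → X × Bool) × (Fin n → X × Bool) |
      ∀ S, IsRejectronOutput C erm (samplePts w.1) (sampleLabels w.1) (samplePts w.2) ε Λ S →
        selErr μt (erm (samplePts w.1) (sampleLabels w.1)) S ≤
          8 * Λ * clfErr μ f + 2 * clfErr μt f + Λ * ε ^ 2 + 3 * ε}
    set B := {w : Fin n → X × Bool | ∀ (xt : Fin n → X) (S : Set X),
      IsRejectronOutput C erm (samplePts w) (sampleLabels w) xt ε Λ S →
        rejRate μ S ≤ 2 / Λ + 2 * ε}
    have hAc : ((iidLaw n μ).prod (iidLaw n μt)).real Aᶜ = 1 - _ :=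
      probReal_compl_eq_one_sub MeasurableSet.of_discrete
    have hBc : (iidLaw n μ).real Bᶜ = 1 - _ :=
      probReal_compl_eq_one_sub MeasurableSet.of_discrete
    refine one_sub_le_measureReal_of_compl_subset _ _ (Aᶜ ∪ Bᶜ ×ˢ Set.univ) δ ?_ ?_
    · refine (measureReal_union_le _ _).trans ?_
      rw [measureReal_prod_prod, probReal_univ]
      linarith
    · intro w hw S hS
      have hwA : w ∈ A := by
        by_contra h
        exact hw (Or.inl h)
      have hwB : w.1 ∈ B := by
        by_contra h
        exact hw (Or.inr ⟨h, trivial⟩)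
      have h1 := hwA S hS
      have h2 := hwB (samplePts w.2) S hS
      have h3 := mul_le_mul_of_nonneg_left hfη hΛ0.le
      exact ⟨by linarith, by linarith⟩
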